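/- Let $m\ge 2$ and let $(X_n)_{n\ge 0}$ be an irreducible, aperiodic, homogeneous Markov chain on the ordered alphabet $\{1<2<\dots<m\}$ with transition matrix $P$ and stationary distribution $(\pi_1,\dots,\pi_m)$, started from its stationary distribution. For a letter $a$ and $k\ge 0$ let $T^a_k=\#\{1\le i\le k: X_i=a\}-\pi_a k$, and let $\Sigma=(\sigma_{a,b})$ be the asymptotic covariance matrix, $\sigma_{a,b}=\lim_{k\to\infty}\mathrm{Cov}(T^a_k,T^b_k)/k$; put $\sigma_a=\sqrt{\sigma_{a,a}}$. Let $\tilde B=(\tilde B^1,\dots,\tilde B^m)$ be an $m$-dimensional Brownian motion on $[0,1]$ (a continuous centered Gaussian process) with $\mathrm{Cov}(\tilde B^a(s),\tilde B^b(t))=\min(s,t)\,\sigma_{a,b}/(\sigma_a\sigma_b)$. Let $\tau$ be the permutation of $\{1,\dots,m\}$ with $\pi_{\tau(1)}\ge\dots\ge\pi_{\tau(m)}$ and $\tau(i)<\tau(j)$ whenever $i<j$ and $\pi_{\tau(i)}=\pi_{\tau(j)}$. For $1\le r\le m$ let $d_r$ be the multiplicity of $\pi_{\tau(r)}$ among $\pi_1,\dots,\pi_m$,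 and let $m_r=\max\{i:\pi_{\tau(i)}>\pi_{\tau(r)}\}$ (with $m_r=0$ if there is no such $i$). For $0\le s\le d$ let $$I_{s,d}=\bigl\{(t_{j,\ell})_{1\le j\le s,\,0\le \ell\le d}\in[0,1]^{s(d+1)}:\ t_{j,j-1}=0,\ t_{j,d-s+j}=1\ (1\le j\le s);\ t_{j,\ell-1}\le t_{j,\ell}\ (1\le j\le s,\,1\le\ell\le d);\ t_{j,\ell}\le t_{j-1,\ell-1}\ (2\le j\le s,\,1\le \ell\le d)\bigr\}.$$ Then for every $1\le r\le m-1$, $$\begin{aligned}V^r_\infty:={}&\sum_{i=1}^{m_r}\sigma_{\tau(i)}\tilde B^{\tau(i)}(1)+\max_{t\in I_{r-m_r,d_r}}\sum_{j=1}^{r-m_r}\ \sum_{\ell=j}^{m_r+d_r-r+j}\sigma_{\tau(m_r+\ell)}\bigl(\tilde B^{\tau(m_r+\ell)}(t_{j,\ell})-\tilde B^{\tau(m_r+\ell)}(t_{j,\ell-1})\bigr)\\ \stackrel{\mathcal L}{=}{}&\sum_{i=m_r+d_r+1}^{m}\sigma_{\tau(i)}\tilde B^{\tau(i)}(1)+\max_{u\in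 I_{m_r+d_r-r,d_r}}\sum_{j=1}^{m_r+d_r-r}\ \sum_{\ell=j}^{r-m_r+j}\sigma_{\tau(m_r+\ell)}\bigl(\tilde B^{\tau(m_r+\ell)}(u_{j,\ell})-\tilde B^{\tau(m_r+\ell)}(u_{j,\ell-1})\bigr),\end{aligned}$$ where empty sums are $0$ and the second maximum is $0$ if $m_r+d_r=r$. -/

import Mathlib

noncomputable section

open MeasureTheory ProbabilityTheory Filter Topology

/-! ### The Markov chain and its asymptotic covariance matrix -/

/-- `X` is a homogeneous Markov chain on the ordered alphabet `Fin m` with initial law `p` and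
transition matrix `P`, given through the probabilities of its finite paths. -/
structure IsMarkovChain {Ω : Type*} [MeasurableSpace Ω] {m : ℕ} (P : Matrix (Fin m) (Fin m) ℝ)
    (p : Fin m → ℝ) (X : ℕ → Ω → Fin m) (μ : Measure Ω) : Prop where
  measurable : ∀ n, Measurable (X n)
  path_prob : ∀ (n : ℕ) (x : ℕ → Fin m),
    μ.real {ω | ∀ i ≤ n, X i ω = x i} = p (x 0) * ∏ i ∈ Finset.range n, P (x i) (x (i + 1))

/-- Every state has period one: the only common divisor of the lengths of its possible
returns is `1`. -/
def IsAperiodic {m : ℕ} (P : Matrix (Fin m) (Fin m) ℝ) : Prop :=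
  ∀ (a : Fin m) (q : ℕ), (∀ n : ℕ, 1 ≤ n → 0 < (P ^ n) a a → q ∣ n) → q = 1

/-- `p` is a stationary distribution of the transition matrix `P`. -/
structure IsStationaryDistribution {m : ℕ} (P : Matrix (Fin m) (Fin m) ℝ) (p : Fin m → ℝ) : Prop where
  mem_stdSimplex : p ∈ stdSimplex ℝ (Fin m)
  vecMul_eq : Matrix.vecMul p P = p

/-- `T^a_k`: the number of `1 ≤ i ≤ k` with `X_i = a`, minus `p_a k`. -/
def centeredCount {Ω : Type*} {m : ℕ} (p : Fin m → ℝ) (X : ℕ → Ω → Fin m)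
    (a : Fin m) (k : ℕ) (ω : Ω) : ℝ :=
  ((Finset.Icc 1 k).filter fun i => X i ω = a).card - p a * k

/-- The asymptotic covariance matrix `Σ`, with entries `lim_k Cov(T^a_k, T^b_k) / k`. -/
def asymptoticCov {Ω : Type*} [MeasurableSpace Ω] {m : ℕ} (p : Fin m → ℝ)
    (X : ℕ → Ω → Fin m) (μ : Measure Ω) : Matrix (Fin m) (Fin m) ℝ :=
  Matrix.of fun a b => limUnder atTop fun k : ℕ =>
    cov[centeredCount p X a k, centeredCount p X b k; μ] / (k : ℝ)

/-- `σ_a = √Σ_{a,a}`. -/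
def stdDev {m : ℕ} (S : Matrix (Fin m) (Fin m) ℝ) (a : Fin m) : ℝ := √(S a a)

/-- The correlation matrix `Σ_{a,b} / (σ_a σ_b)`. -/
def correlation {m : ℕ} (S : Matrix (Fin m) (Fin m) ℝ) : Matrix (Fin m) (Fin m) ℝ :=
  Matrix.of fun a b => S a b / (stdDev S a * stdDev S b)

/-- `B = (B^1(t), …, B^m(t))`, `0 ≤ t ≤ 1`, is an `m`-dimensional Brownian motion with covariance
matrix `t C`: a centered Gaussian process with almost surely continuous paths and
`Cov(B^a(s), B^b(t)) = min(s, t) C_{a,b}` (so that `B(0) = 0` almost surely). -/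
structure IsBrownianMotionWithCov {Ω : Type*} [MeasurableSpace Ω] {m : ℕ}
    (C : Matrix (Fin m) (Fin m) ℝ) (B : unitInterval → Ω → Fin m → ℝ) (μ : Measure Ω) : Prop where
  gaussian : IsGaussianProcess B μ
  centered : ∀ t a, ∫ ω, B t ω a ∂μ = 0
  covariance : ∀ s t a b,
    cov[fun ω => B s ω a, fun ω => B t ω b; μ] = min (s : ℝ) (t : ℝ) * C a b
  continuous : ∀ᵐ ω ∂μ, Continuous fun t => B t ω

/-! ### Ranking the letters by stationary probability -/

/-- `τ` sorts the letters by decreasing probability, ties being broken by the order of the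
alphabet. -/
structure IsRanking {m : ℕ} (p : Fin m → ℝ) (τ : Equiv.Perm (Fin m)) : Prop where
  antitone : ∀ i j, i ≤ j → p (τ j) ≤ p (τ i)
  tie : ∀ i j, i < j → p (τ i) = p (τ j) → τ i < τ j

/-- `f_{τ(i)}` for a position `i ∈ {1, …, m}` (counted from one); `0` for other `i`, which are
never used. -/
def ranked {α : Type*} [Zero α] {m : ℕ} (τ : Equiv.Perm (Fin m)) (f : Fin m → α) (i : ℕ) : α :=
  if h : 1 ≤ i ∧ i ≤ m then f (τ ⟨i - 1, by omega⟩) else 0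

/-- `d_r`: the multiplicity of `p_{τ(r)}`. -/
def letterMultiplicity {m : ℕ} (p : Fin m → ℝ) (τ : Equiv.Perm (Fin m)) (r : ℕ) : ℕ :=
  (Finset.univ.filter fun a => p a = ranked τ p r).card

/-- `m_r`: the largest `i ∈ {1, …, m}` with `p_{τ(i)} > p_{τ(r)}`, and `0` if there is none. -/
def lastAbove {m : ℕ} (p : Fin m → ℝ) (τ : Equiv.Perm (Fin m)) (r : ℕ) : ℕ :=
  ((Finset.Icc 1 m).filter fun i => ranked τ p r < ranked τ p i).sup id

/-! ### The Brownian functionals -/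

/-- The index set `I_{s,d}` of arrays `t_{j,ℓ} ∈ [0,1]`, `1 ≤ j ≤ s`, `0 ≤ ℓ ≤ d`. Row `j` runs
through the letters in increasing order and occupies letter `ℓ` during `[t_{j,ℓ-1}, t_{j,ℓ}]`; the
last condition says that row `j` has left letter `ℓ` before row `j - 1` enters it, so that
the rows occupy different letters at each time. Entries outside the stated range are irrelevant. -/
def staircase (s d : ℕ) : Set (ℕ → ℕ → unitInterval) :=
  {t | (∀ j, 1 ≤ j → j ≤ s → t j (j - 1) = 0 ∧ t j (d - s + j) = 1) ∧
    (∀ j ℓ, 1 ≤ j → j ≤ s → 1 ≤ ℓ → ℓ ≤ d → t j (ℓ - 1) ≤ t j ℓ) ∧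
    (∀ j ℓ, 2 ≤ j → j ≤ s → 1 ≤ ℓ → ℓ ≤ d → t j ℓ ≤ t (j - 1) (ℓ - 1))}

/-- The maximum over `t ∈ I_{s,d}` of
`∑_{j=1}^{s} ∑_{ℓ=j}^{d-s+j} (x_ℓ(t_{j,ℓ}) - x_ℓ(t_{j,ℓ-1}))`, for paths `x_1, …, x_d` on `[0,1]`.
It is `0` for `s = 0`. -/
def staircaseMax (s d : ℕ) (x : ℕ → unitInterval → ℝ) : ℝ :=
  sSup ((fun t : ℕ → ℕ → unitInterval => ∑ j ∈ Finset.Icc 1 s, ∑ ℓ ∈ Finset.Icc j (d - s + j),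
    (x ℓ (t j ℓ) - x ℓ (t j (ℓ - 1)))) '' staircase s d)

/-- The paths `σ_{τ(i)} B^{τ(i)}`, `1 ≤ i ≤ m`. -/
def rankedPath {Ω : Type*} {m : ℕ} (sd : Fin m → ℝ) (τ : Equiv.Perm (Fin m))
    (B : unitInterval → Ω → Fin m → ℝ) (ω : Ω) : ℕ → unitInterval → ℝ :=
  ranked τ fun a t => sd a * B t ω a

/-- The limiting functional `V^r_∞`. -/
def limitFunctional {Ω : Type*} {m : ℕ} (p sd : Fin m → ℝ) (τ : Equiv.Perm (Fin m))
    (B : unitInterval → Ω → Fin m → ℝ) (r : ℕ) (ω : Ω) : ℝ :=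
  ∑ i ∈ Finset.Icc 1 (lastAbove p τ r), rankedPath sd τ B ω i 1 +
    staircaseMax (r - lastAbove p τ r) (letterMultiplicity p τ r)
      fun ℓ => rankedPath sd τ B ω (lastAbove p τ r + ℓ)

/-- The mirrored functional: letters of smaller probability, and the remaining
`m_r + d_r - r` rows on the letters of probability `p_{τ(r)}`. -/
def mirrorFunctional {Ω : Type*} {m : ℕ} (p sd : Fin m → ℝ) (τ : Equiv.Perm (Fin m))
    (B : unitInterval → Ω → Fin m → ℝ) (r : ℕ) (ω : Ω) : ℝ :=
  ∑ i ∈ Finset.Icc (lastAbove p τ r + letterMultiplicity p τ r + 1) m, rankedPath sd τ B ω i 1 +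
    staircaseMax (lastAbove p τ r + letterMultiplicity p τ r - r) (letterMultiplicity p τ r)
      fun ℓ => rankedPath sd τ B ω (lastAbove p τ r + ℓ)

end

/-!
In a staircase array of `s` rows on `d` letters the rows occupy `s` different letters at each time.
The letters that they leave free are occupied by `d - s` rows that run backward in time, so the
staircase maximum of `x_1, …, x_d` is `∑_ℓ (x_ℓ(1) - x_ℓ(0))` plus the staircase maximum with
`d - s` rows of the reversed paths `x_ℓ(1 - t) - x_ℓ(1)`.

The counts satisfy `∑_a T^a_k = 0`, so the rows of `Σ` sum to zero, and `∑_a σ_a B^a(1)`, which has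
variance `∑_{a,b} Σ_{a,b}`, vanishes almost surely. Hence the limiting functional of `B` is almost
surely the mirrored functional of the reversed process, and this process has the law of `B`.
-/

open MeasureTheory ProbabilityTheory Filter Topology

/-! ### Complementary staircases -/

/-- The path run backwards in time and started at `0`. -/
def reversePath (x : unitInterval → ℝ) (u : unitInterval) : ℝ := x (unitInterval.symm u) - x 1

theorem reversePath_zero (x : unitInterval → ℝ) : reversePath x 0 = 0 := by
  simp [reversePath]

theorem reversePath_one (x : unitInterval → ℝ) : reversePath x 1 = x 0 - x 1 := by
  simp [reversePath]

theorem continuous_reversePath {x : unitInterval → ℝ} (hx : Continuous x) :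
    Continuous (reversePath x) := by
  unfold reversePath
  fun_prop

/-- The array whose `h`-th row is, in reversed time, always at the `h`-th smallest of the letters
that the `s` rows of `t` leave free. The free row `h` jumps over row `j` of `t`, which is going down
from letter `ℓ + 1` to `ℓ = h + j - 1` in reversed time, when `t j ℓ` is passed. -/
def complementArray (s : ℕ) (t : ℕ → ℕ → unitInterval) (h ℓ : ℕ) : unitInterval :=
  if ℓ < h then 0 else if s + h ≤ ℓ then 1 else unitInterval.symm (t (ℓ - h + 1) ℓ)

section complementArray

variable {s d h ℓ : ℕ} {t : ℕ → ℕ → unitInterval}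

theorem complementArray_of_lt (hℓ : ℓ < h) : complementArray s t h ℓ = 0 :=
  if_pos hℓ

theorem complementArray_of_ge (hℓ : s + h ≤ ℓ) : complementArray s t h ℓ = 1 := by
  rw [complementArray, if_neg (by omega), if_pos hℓ]

theorem complementArray_of_mem (hℓ : h ≤ ℓ) (hℓ' : ℓ < s + h) :
    complementArray s t h ℓ = unitInterval.symm (t (ℓ - h + 1) ℓ) := by
  rw [complementArray, if_neg (by omega), if_neg (by omega)]

theorem complementArray_mem_staircase (hs : s ≤ d) (ht : t ∈ staircase s d) :
    complementArray s t ∈ staircase (d - s) d := by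
  obtain ⟨-, hmono, hsep⟩ := ht
  refine ⟨fun j _ _ => ⟨complementArray_of_lt (by omega), complementArray_of_ge (by omega)⟩,
    fun j ℓ _ _ _ _ => ?_, fun j ℓ _ _ _ _ => ?_⟩
  · rcases lt_or_ge (ℓ - 1) j with h | h
    · exact (complementArray_of_lt h).trans_le unitInterval.nonneg'
    rcases lt_or_ge ℓ (s + j) with h' | h'
    · rw [complementArray_of_mem h (by omega), complementArray_of_mem (by omega) h',
        unitInterval.symm_le_symm, show ℓ - 1 - j + 1 = ℓ - j + 1 - 1 by omega]
      exact hsep (ℓ - j + 1) ℓ (by omega) (by omega) (by omega) (by omega)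
    · exact unitInterval.le_one'.trans_eq (complementArray_of_ge h').symm
  · rcases lt_or_ge ℓ j with h | h
    · exact (complementArray_of_lt h).trans_le unitInterval.nonneg'
    rcases lt_or_ge ℓ (s + j) with h' | h'
    · rw [complementArray_of_mem h h', complementArray_of_mem (by omega) (by omega),
        unitInterval.symm_le_symm, show ℓ - 1 - (j - 1) + 1 = ℓ - j + 1 by omega]
      exact hmono _ ℓ (by omega) (by omega) (by omega) (by omega)
    · exact unitInterval.le_one'.trans_eq (complementArray_of_ge (by omega)).symm

end complementArray

theorem staircase_nonempty {s d : ℕ} (hs : s ≤ d) : (staircase s d).Nonempty := by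
  refine ⟨fun j ℓ => if d - s + j ≤ ℓ then 1 else 0,
    fun j _ _ => ⟨if_neg (by omega), if_pos le_rfl⟩, fun j ℓ _ _ _ _ => ?_,
    fun j ℓ _ _ _ _ => (if_congr (by omega) rfl rfl).le⟩
  by_cases h : d - s + j ≤ ℓ
  · exact unitInterval.le_one'.trans_eq (if_pos h).symm
  · exact (if_neg (by omega)).trans_le unitInterval.nonneg'

theorem isCompact_staircase (s d : ℕ) : IsCompact (staircase s d) := by
  refine IsClosed.isCompact ?_
  simp only [staircase, Set.ofPred_and, Set.ofPred_forall]
  refine .inter ?_ (.inter ?_ ?_)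
  · refine isClosed_iInter fun j => isClosed_iInter fun _ => isClosed_iInter fun _ =>
      .inter ?_ ?_ <;> exact isClosed_eq (by fun_prop) (by fun_prop)
  all_goals
    refine isClosed_iInter fun j => isClosed_iInter fun ℓ => isClosed_iInter fun _ =>
      isClosed_iInter fun _ => isClosed_iInter fun _ => isClosed_iInter fun _ => ?_
    exact isClosed_le (by fun_prop) (by fun_prop)

/-- The quantity that is maximized in `staircaseMax`. -/
def staircaseSum (s d : ℕ) (x : ℕ → unitInterval → ℝ) (t : ℕ → ℕ → unitInterval) : ℝ :=
  ∑ j ∈ Finset.Icc 1 s, ∑ ℓ ∈ Finset.Icc j (d - s + j), (x ℓ (t j ℓ) - x ℓ (t j (ℓ - 1)))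

/-- The contribution of a jump of a row from letter `ℓ` to letter `ℓ + 1` at time `u`: up to
boundary terms, `staircaseSum` is the sum of these over all jumps of all rows. -/
def jumpGain (x : ℕ → unitInterval → ℝ) (ℓ : ℕ) (u : unitInterval) : ℝ := x ℓ u - x (ℓ + 1) u

theorem continuous_staircaseSum (s d : ℕ) {x : ℕ → unitInterval → ℝ} (hx : ∀ ℓ, Continuous (x ℓ)) :
    Continuous (staircaseSum s d x) := by
  unfold staircaseSum
  fun_prop

theorem sum_Icc_one_eq_sum_range {M : Type*} [AddCommMonoid M] (n : ℕ) (f : ℕ → M) :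
    ∑ i ∈ Finset.Icc 1 n, f i = ∑ k ∈ Finset.range n, f (k + 1) := by
  rw [Finset.range_eq_Ico, Finset.sum_Ico_add' f 0 n 1, zero_add, Finset.Ico_add_one_right_eq_Icc]

theorem sum_Icc_sub_eq_sum_jumpGain (a n : ℕ) (x : ℕ → unitInterval → ℝ) (t : ℕ → unitInterval) :
    ∑ ℓ ∈ Finset.Icc (a + 1) (n + (a + 1)), (x ℓ (t ℓ) - x ℓ (t (ℓ - 1))) =
      ∑ k ∈ Finset.range n, jumpGain x (a + k + 1) (t (a + k + 1)) +
        (x (n + (a + 1)) (t (n + (a + 1))) - x (a + 1) (t a)) := by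
  induction n with
  | zero => simp
  | succ n ih =>
    rw [add_right_comm, Finset.sum_Icc_succ_top (by omega), ih, Finset.sum_range_succ, jumpGain,
      show a + n + 1 = n + (a + 1) by omega, Nat.add_sub_cancel]
    ring

theorem staircaseSum_eq_sum_jumpGain {s d : ℕ} (x : ℕ → unitInterval → ℝ)
    {t : ℕ → ℕ → unitInterval} (ht : t ∈ staircase s d) :
    staircaseSum s d x t =
      ∑ j ∈ Finset.range s, ∑ k ∈ Finset.range (d - s),
        jumpGain x (j + k + 1) (t (j + 1) (j + k + 1)) +
      ∑ j ∈ Finset.range s, (x (d - s + j + 1) 1 - x (j + 1) 0) := by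
  rw [staircaseSum, sum_Icc_one_eq_sum_range, ← Finset.sum_add_distrib]
  refine Finset.sum_congr rfl fun j hj => ?_
  rw [Finset.mem_range] at hj
  obtain ⟨h0, h1⟩ := ht.1 (j + 1) (by omega) (by omega)
  rw [Nat.add_sub_cancel] at h0
  rw [sum_Icc_sub_eq_sum_jumpGain, h0, h1, add_assoc]

theorem jumpGain_reversePath (x : ℕ → unitInterval → ℝ) (ℓ : ℕ) (u : unitInterval) :
    jumpGain (fun i => reversePath (x i)) ℓ (unitInterval.symm u) =
      jumpGain x ℓ u - jumpGain x ℓ 1 := by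
  simp only [jumpGain, reversePath, unitInterval.symm_symm]
  ring

theorem staircaseSum_reversePath_complementArray {s d : ℕ} (hs : s ≤ d)
    (x : ℕ → unitInterval → ℝ) {t : ℕ → ℕ → unitInterval} (ht : t ∈ staircase s d) :
    staircaseSum (d - s) d (fun ℓ => reversePath (x ℓ)) (complementArray s t) =
      ∑ j ∈ Finset.range s, ∑ k ∈ Finset.range (d - s),
        jumpGain x (j + k + 1) (t (j + 1) (j + k + 1)) +
      ∑ k ∈ Finset.range (d - s), (x (s + k + 1) 0 - x (k + 1) 1) := by
  have hgain : ∀ k, ∀ j ∈ Finset.range s,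
      jumpGain (fun i => reversePath (x i)) (k + j + 1) (complementArray s t (k + 1) (k + j + 1)) =
        jumpGain x (j + k + 1) (t (j + 1) (j + k + 1)) - jumpGain x (k + j + 1) 1 := by
    intro k j hj
    rw [Finset.mem_range] at hj
    rw [complementArray_of_mem (by omega) (by omega), jumpGain_reversePath,
      show k + j + 1 - (k + 1) + 1 = j + 1 by omega, add_comm k j]
  have htelescope : ∀ k, ∑ j ∈ Finset.range s, jumpGain x (k + j + 1) 1 =
      x (k + 1) 1 - x (s + k + 1) 1 := fun k => by
    rw [add_comm s k]
    exact Finset.sum_range_sub' (fun j => x (k + j + 1) 1) s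
  rw [staircaseSum_eq_sum_jumpGain _ (complementArray_mem_staircase hs ht), Nat.sub_sub_self hs,
    Finset.sum_congr rfl fun k _ => Finset.sum_congr rfl (hgain k),
    Finset.sum_comm (s := Finset.range s)]
  simp only [Finset.sum_sub_distrib, htelescope, reversePath_zero, reversePath_one,
    Finset.sum_const_zero]
  ring

theorem staircaseSum_eq_add_complementArray {s d : ℕ} (hs : s ≤ d) (x : ℕ → unitInterval → ℝ)
    {t : ℕ → ℕ → unitInterval} (ht : t ∈ staircase s d) :
    staircaseSum s d x t = ∑ ℓ ∈ Finset.Icc 1 d, (x ℓ 1 - x ℓ 0) +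
      staircaseSum (d - s) d (fun ℓ => reversePath (x ℓ)) (complementArray s t) := by
  have hone : ∑ ℓ ∈ Finset.range d, x (ℓ + 1) 1 = ∑ k ∈ Finset.range (d - s), x (k + 1) 1 +
      ∑ j ∈ Finset.range s, x (d - s + j + 1) 1 := by
    rw [← Finset.sum_range_add (fun ℓ => x (ℓ + 1) 1), Nat.sub_add_cancel hs]
  have hzero : ∑ ℓ ∈ Finset.range d, x (ℓ + 1) 0 = ∑ j ∈ Finset.range s, x (j + 1) 0 +
      ∑ k ∈ Finset.range (d - s), x (s + k + 1) 0 := by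
    rw [← Finset.sum_range_add (fun ℓ => x (ℓ + 1) 0), Nat.add_sub_cancel' hs]
  rw [staircaseSum_eq_sum_jumpGain x ht, staircaseSum_reversePath_complementArray hs x ht,
    sum_Icc_one_eq_sum_range]
  simp only [Finset.sum_sub_distrib]
  linear_combination -hone + hzero

theorem staircaseMax_le_add_reversePath {s d : ℕ} (hs : s ≤ d) {x : ℕ → unitInterval → ℝ}
    (hx : ∀ ℓ, Continuous (x ℓ)) :
    staircaseMax s d x ≤ ∑ ℓ ∈ Finset.Icc 1 d, (x ℓ 1 - x ℓ 0) +
      staircaseMax (d - s) d (fun ℓ => reversePath (x ℓ)) := by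
  refine csSup_le ((staircase_nonempty hs).image _) (Set.forall_mem_image.2 fun t ht => ?_)
  refine (staircaseSum_eq_add_complementArray hs x ht).trans_le (add_le_add_right ?_ _)
  exact le_csSup ((isCompact_staircase _ _).bddAbove_image
    (continuous_staircaseSum _ _ fun ℓ => continuous_reversePath (hx ℓ)).continuousOn)
    (Set.mem_image_of_mem _ (complementArray_mem_staircase hs ht))

theorem staircaseMax_reversePath_reversePath (s d : ℕ) (x : ℕ → unitInterval → ℝ) :
    staircaseMax s d (fun ℓ => reversePath (reversePath (x ℓ))) = staircaseMax s d x := by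
  simp [staircaseMax, reversePath]

theorem staircaseMax_eq_add_reversePath {s d : ℕ} (hs : s ≤ d) {x : ℕ → unitInterval → ℝ}
    (hx : ∀ ℓ, Continuous (x ℓ)) :
    staircaseMax s d x = ∑ ℓ ∈ Finset.Icc 1 d, (x ℓ 1 - x ℓ 0) +
      staircaseMax (d - s) d (fun ℓ => reversePath (x ℓ)) := by
  refine le_antisymm (staircaseMax_le_add_reversePath hs hx) ?_
  have h := staircaseMax_le_add_reversePath (Nat.sub_le d s) fun ℓ => continuous_reversePath (hx ℓ)
  rw [Nat.sub_sub_self hs, staircaseMax_reversePath_reversePath] at h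
  simp only [reversePath_zero, reversePath_one, sub_zero, Finset.sum_sub_distrib] at h ⊢
  linarith

/-! ### The Poisson equation of an irreducible chain -/

section Poisson

open Matrix

variable {ι : Type*} [Fintype ι] [DecidableEq ι] {P : Matrix ι ι ℝ} {p : ι → ℝ}

theorem pow_mulVec_eq_self {g : ι → ℝ} (hg : P *ᵥ g = g) (n : ℕ) : P ^ n *ᵥ g = g := by
  induction n with
  | zero => rw [pow_zero, one_mulVec]
  | succ n ih => rw [pow_succ, ← mulVec_mulVec, hg, ih]

theorem vecMul_pow_eq_self (hpP : p ᵥ* P = p) (n : ℕ) : p ᵥ* P ^ n = p := by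
  induction n with
  | zero => rw [pow_zero, vecMul_one]
  | succ n ih => rw [pow_succ, ← vecMul_vecMul, ih, hpP]

theorem abs_mulVec_le (hP : P ∈ rowStochastic ℝ ι) (g : ι → ℝ) (b : ι) :
    |(P *ᵥ g) b| ≤ ∑ c, |g c| := by
  refine (Finset.abs_sum_le_sum_abs _ _).trans (Finset.sum_le_sum fun c _ => ?_)
  rw [abs_mul, abs_of_nonneg (nonneg_of_mem_rowStochastic hP)]
  exact mul_le_of_le_one_left (abs_nonneg _) (le_one_of_mem_rowStochastic hP)

theorem eq_of_mulVec_eq_self (hP : P ∈ rowStochastic ℝ ι) (hirr : P.IsIrreducible) {g : ι → ℝ}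
    (hg : P *ᵥ g = g) (b c : ι) : g b = g c := by
  have : Nonempty ι := ⟨b⟩
  obtain ⟨a, ha⟩ := Finite.exists_max g
  suffices hmax : ∀ b, g b = g a from (hmax b).trans (hmax c).symm
  intro b
  obtain ⟨k, -, hk⟩ := (isIrreducible_iff_exists_pow_pos hP.1).1 hirr a b
  have hPk : P ^ k ∈ rowStochastic ℝ ι := pow_mem hP k
  have hmean : ∑ c, (P ^ k) a c * g c = g a := congrFun (pow_mulVec_eq_self hg k) a
  have hgap : ∑ c, (P ^ k) a c * (g a - g c) = 0 := by
    simp only [mul_sub, Finset.sum_sub_distrib]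
    rw [hmean, ← Finset.sum_mul, sum_row_of_mem_rowStochastic hPk, one_mul, sub_self]
  have hzero := (Finset.sum_eq_zero_iff_of_nonneg fun c _ =>
    mul_nonneg (hPk.1 a c) (sub_nonneg.2 (ha c))).1 hgap b (Finset.mem_univ b)
  exact (sub_eq_zero.1 ((mul_eq_zero.1 hzero).resolve_left hk.ne')).symm

theorem exists_sub_mulVec_eq (hP : P ∈ rowStochastic ℝ ι) (hirr : P.IsIrreducible)
    (hpP : p ᵥ* P = p) (hp1 : p ⬝ᵥ 1 = 1) {f : ι → ℝ} (hf : p ⬝ᵥ f = 0) :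
    ∃ g : ι → ℝ, g - P *ᵥ g = f := by
  -- The rank-one perturbation makes `1 - P` invertible without changing it on the kernel of `p`.
  let A : Matrix ι ι ℝ := 1 - P + vecMulVec 1 p
  have hA : ∀ g, A *ᵥ g = g - P *ᵥ g + (p ⬝ᵥ g) • 1 := fun g => by
    simp only [A, add_mulVec, sub_mulVec, one_mulVec, vecMulVec_mulVec, op_smul_eq_smul]
  have hpA : ∀ g, p ⬝ᵥ (A *ᵥ g) = p ⬝ᵥ g := fun g => by
    rw [hA, dotProduct_add, dotProduct_sub, dotProduct_mulVec, hpP, dotProduct_smul, hp1, sub_self,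
      zero_add, smul_eq_mul, mul_one]
  have hinj : Function.Injective A.mulVec :=
    (injective_iff_map_eq_zero (mulVecLin A)).2 fun g (hg : A *ᵥ g = 0) => by
      have hpg : p ⬝ᵥ g = 0 := by rw [← hpA, hg, dotProduct_zero]
      rw [hA, hpg, zero_smul, add_zero, sub_eq_zero] at hg
      ext b
      have hconst : g = g b • 1 := by
        ext c
        simpa using eq_of_mulVec_eq_self hP hirr hg.symm c b
      rwa [hconst, dotProduct_smul, hp1, smul_eq_mul, mul_one] at hpg
  obtain ⟨g, hg⟩ := mulVec_surjective_iff_isUnit.2 (mulVec_injective_iff_isUnit.1 hinj) f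
  have hpg : p ⬝ᵥ g = 0 := by rw [← hpA, hg, hf]
  exact ⟨g, by rwa [hA, hpg, zero_smul, add_zero] at hg⟩

theorem sum_range_pow_mulVec_sub (P : Matrix ι ι ℝ) (g : ι → ℝ) (n : ℕ) (b : ι) :
    ∑ i ∈ Finset.range n, (P ^ i *ᵥ (g - P *ᵥ g)) b = g b - (P ^ n *ᵥ g) b := by
  simp only [mulVec_sub, mulVec_mulVec, ← pow_succ, Pi.sub_apply]
  rw [Finset.sum_range_sub' fun i => (P ^ i *ᵥ g) b, pow_zero, one_mulVec]

theorem tendsto_cesaro_pow_mulVec (hP : P ∈ rowStochastic ℝ ι) (hirr : P.IsIrreducible)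
    (hpP : p ᵥ* P = p) (hp1 : p ⬝ᵥ 1 = 1) (f : ι → ℝ) (b : ι) :
    Tendsto (fun n : ℕ => (n : ℝ)⁻¹ * ∑ i ∈ Finset.range n, (P ^ i *ᵥ f) b) atTop
      (𝓝 (p ⬝ᵥ f)) := by
  obtain ⟨g, hg⟩ := exists_sub_mulVec_eq hP hirr hpP hp1 (f := f - (p ⬝ᵥ f) • 1)
    (by rw [dotProduct_sub, dotProduct_smul, hp1, smul_eq_mul, mul_one, sub_self])
  have hsum : ∀ n : ℕ, ∑ i ∈ Finset.range n, (P ^ i *ᵥ f) b =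
      g b - (P ^ n *ᵥ g) b + n * (p ⬝ᵥ f) := fun n => by
    have hone : ∀ i, P ^ i *ᵥ (1 : ι → ℝ) = 1 := fun i => (pow_mem hP i).2
    rw [← sum_range_pow_mulVec_sub, hg]
    simp only [mulVec_sub, mulVec_smul, hone, Pi.sub_apply, Pi.smul_apply, Pi.one_apply,
      smul_eq_mul, mul_one, Finset.sum_sub_distrib, Finset.sum_const, Finset.card_range,
      nsmul_eq_mul, sub_add_cancel]
  have hbdd : Tendsto (fun n : ℕ => (n : ℝ)⁻¹ * (g b - (P ^ n *ᵥ g) b)) atTop (𝓝 0) :=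
    tendsto_inv_atTop_nhds_zero_nat.zero_mul_isBoundedUnder_le <|
      isBoundedUnder_of ⟨|g b| + ∑ c, |g c|, fun n =>
        (norm_sub_le _ _).trans (add_le_add_right (abs_mulVec_le (pow_mem hP n) g b) _)⟩
  have hlim := hbdd.add_const (p ⬝ᵥ f)
  rw [zero_add] at hlim
  refine hlim.congr' ?_
  filter_upwards [eventually_ne_atTop 0] with n hn
  rw [hsum, mul_add, inv_mul_cancel_left₀ (Nat.cast_ne_zero.2 hn)]

theorem exists_tendsto_cesaro_sum_pow_mulVec (hP : P ∈ rowStochastic ℝ ι) (hirr : P.IsIrreducible)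
    (hpP : p ᵥ* P = p) (hp1 : p ⬝ᵥ 1 = 1) {f : ι → ℝ} (hf : p ⬝ᵥ f = 0) (b : ι) :
    ∃ l, Tendsto (fun n : ℕ => (n : ℝ)⁻¹ * ∑ i ∈ Finset.range n,
      ∑ k ∈ Finset.range i, (P ^ k *ᵥ f) b) atTop (𝓝 l) := by
  obtain ⟨g, rfl⟩ := exists_sub_mulVec_eq hP hirr hpP hp1 hf
  refine ⟨g b - p ⬝ᵥ g, ((tendsto_cesaro_pow_mulVec hP hirr hpP hp1 g b).const_sub (g b)).congr' ?_⟩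
  filter_upwards [eventually_ne_atTop 0] with n hn
  simp only [sum_range_pow_mulVec_sub, Finset.sum_sub_distrib, Finset.sum_const, Finset.card_range,
    nsmul_eq_mul, mul_sub, inv_mul_cancel_left₀ (Nat.cast_ne_zero (R := ℝ).2 hn)]

theorem exists_tendsto_cesaro_sum_pow_apply_sub (hP : P ∈ rowStochastic ℝ ι)
    (hirr : P.IsIrreducible) (hpP : p ᵥ* P = p) (hp1 : p ⬝ᵥ 1 = 1) (a b : ι) :
    ∃ l, Tendsto (fun n : ℕ => (n : ℝ)⁻¹ * ∑ i ∈ Finset.range n,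
      ∑ k ∈ Finset.range i, ((P ^ (k + 1)) a b - p b)) atTop (𝓝 l) := by
  have hcol : p ⬝ᵥ (P.col b - p b • 1) = 0 := by
    rw [dotProduct_sub, dotProduct_smul, hp1, smul_eq_mul, mul_one, sub_eq_zero]
    exact congrFun hpP b
  have hpow : ∀ k, (P ^ (k + 1)) a b - p b = (P ^ k *ᵥ (P.col b - p b • 1)) a := fun k => by
    rw [mulVec_sub, mulVec_smul, (pow_mem hP k).2, pow_succ]
    simp [mul_apply, mulVec, dotProduct]
  simp only [hpow]
  exact exists_tendsto_cesaro_sum_pow_mulVec hP hirr hpP hp1 hcol a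

end Poisson

/-! ### Laws of pairs of letters -/

section Chain

open Matrix

theorem sum_measureReal_inter_eq {α ι : Type*} [MeasurableSpace α] {μ : Measure α}
    [IsFiniteMeasure μ] [Fintype ι] [MeasurableSpace ι] [MeasurableSingletonClass ι] {f : α → ι}
    (hf : Measurable f) (s : Set α) : ∑ a, μ.real ({x | f x = a} ∩ s) = μ.real s := by
  have hfiber : ∀ a, MeasurableSet (f ⁻¹' {a}) := fun a => hf (measurableSet_singleton a)
  have hsum := sum_measureReal_preimage_singleton (μ := μ.restrict s) (f := f) Finset.univ
    fun a _ => hfiber a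
  rw [Finset.coe_univ, Set.preimage_univ, measureReal_restrict_apply_univ] at hsum
  rw [← hsum]
  exact Finset.sum_congr rfl fun a _ => (measureReal_restrict_apply (hfiber a)).symm

namespace IsMarkovChain

variable {Ω : Type*} [MeasurableSpace Ω] {μ : Measure Ω} {m : ℕ} {P : Matrix (Fin m) (Fin m) ℝ}
  {p : Fin m → ℝ} {X : ℕ → Ω → Fin m}

theorem measurableSet_eq (hX : IsMarkovChain P p X μ) (n : ℕ) (a : Fin m) :
    MeasurableSet {ω | X n ω = a} :=
  hX.measurable n (measurableSet_singleton a)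

theorem measureReal_zero_eq (hX : IsMarkovChain P p X μ) (a : Fin m) :
    μ.real {ω | X 0 ω = a} = p a := by
  simpa using hX.path_prob 0 fun _ => a

theorem shift_one [IsFiniteMeasure μ] (hX : IsMarkovChain P p X μ) :
    IsMarkovChain P (p ᵥ* P) (fun n => X (n + 1)) μ where
  measurable n := hX.measurable (n + 1)
  path_prob n x := by
    let cons (b : Fin m) (i : ℕ) : Fin m := Nat.casesOn i b x
    have hcons : ∀ b, {ω | X 0 ω = b} ∩ {ω | ∀ i ≤ n, X (i + 1) ω = x i} =
        {ω | ∀ i ≤ n + 1, X i ω = cons b i} := fun b => by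
      ext ω
      simp only [Set.mem_inter_iff, Set.mem_ofPred_eq, ← Nat.lt_succ_iff, Nat.forall_lt_succ_left]
      rfl
    rw [← sum_measureReal_inter_eq (hX.measurable 0)]
    simp only [hcons, hX.path_prob, Finset.prod_range_succ', vecMul, dotProduct, Finset.sum_mul]
    refine Finset.sum_congr rfl fun b _ => ?_
    rw [mul_assoc, mul_comm (P b (x 0))]
    rfl

theorem shift [IsFiniteMeasure μ] (hX : IsMarkovChain P p X μ) (n : ℕ) :
    IsMarkovChain P (p ᵥ* P ^ n) (fun k => X (n + k)) μ := by
  induction n with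
  | zero => simpa using hX
  | succ n ih => simpa [pow_succ, vecMul_vecMul, add_right_comm, add_assoc] using ih.shift_one

theorem restrict (hX : IsMarkovChain P p X μ) (a : Fin m) :
    IsMarkovChain P (Pi.single a (p a)) X (μ.restrict {ω | X 0 ω = a}) where
  measurable := hX.measurable
  path_prob n x := by
    rw [measureReal_restrict_apply' (hX.measurableSet_eq 0 a)]
    rcases eq_or_ne (x 0) a with rfl | hxa
    · rw [Pi.single_eq_same, ← hX.path_prob]
      congr 1
      exact Set.inter_eq_left.2 fun ω hω => hω 0 n.zero_le
    · rw [Pi.single_eq_of_ne hxa, zero_mul, (Set.disjoint_left.2 fun ω hω hωa =>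
        hxa ((hω 0 n.zero_le).symm.trans hωa)).inter_eq, measureReal_empty]

theorem measureReal_eq [IsFiniteMeasure μ] (hX : IsMarkovChain P p X μ) (n : ℕ) (a : Fin m) :
    μ.real {ω | X n ω = a} = (p ᵥ* P ^ n) a :=
  (hX.shift n).measureReal_zero_eq a

theorem measureReal_eq_inter_eq [IsFiniteMeasure μ] (hX : IsMarkovChain P p X μ) (i n : ℕ)
    (a b : Fin m) :
    μ.real ({ω | X i ω = a} ∩ {ω | X (i + n) ω = b}) = (p ᵥ* P ^ i) a * (P ^ n) a b := by
  have hlaw := ((hX.shift i).restrict a).measureReal_eq n b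
  rwa [measureReal_restrict_apply ((hX.shift i).measurableSet_eq n b), Set.inter_comm,
    single_vecMul] at hlaw

end IsMarkovChain

end Chain

/-! ### The asymptotic covariance matrix -/

section Covariance

theorem sum_range_sum_range_toeplitz {M : Type*} [AddCommMonoid M] {F : ℕ → ℕ → M}
    {γ δ : ℕ → M} {c : M} (hγ : ∀ i n, F i (i + n + 1) = γ n) (hδ : ∀ i n, F (i + n + 1) i = δ n)
    (hc : ∀ i, F i i = c) (k : ℕ) :
    ∑ i ∈ Finset.range k, ∑ j ∈ Finset.range k, F i j =
      ∑ i ∈ Finset.range k, (∑ n ∈ Finset.range i, γ n + ∑ n ∈ Finset.range i, δ n + c) := by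
  have hcol : ∀ k, ∑ i ∈ Finset.range k, F i k = ∑ n ∈ Finset.range k, γ n := fun k => by
    rw [← Finset.sum_range_reflect]
    refine Finset.sum_congr rfl fun n hn => ?_
    rw [Finset.mem_range] at hn
    rw [← hγ (k - 1 - n) n, show k - 1 - n + n + 1 = k by omega]
  have hrow : ∀ k, ∑ j ∈ Finset.range k, F k j = ∑ n ∈ Finset.range k, δ n := fun k => by
    rw [← Finset.sum_range_reflect]
    refine Finset.sum_congr rfl fun n hn => ?_
    rw [Finset.mem_range] at hn
    rw [← hδ (k - 1 - n) n, show k - 1 - n + n + 1 = k by omega]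
  induction k with
  | zero => rfl
  | succ k ih =>
    simp only [Finset.sum_range_succ, Finset.sum_add_distrib] at ih ⊢
    rw [ih, hcol, hrow, hc]
    abel

theorem covariance_sq_le_variance_mul_variance {Ω : Type*} [MeasurableSpace Ω] {μ : Measure Ω}
    [IsFiniteMeasure μ] {U V : Ω → ℝ} (hU : MemLp U 2 μ) (hV : MemLp V 2 μ) :
    cov[U, V; μ] ^ 2 ≤ Var[U; μ] * Var[V; μ] := by
  have hdiscrim : discrim Var[V; μ] (2 * cov[U, V; μ]) Var[U; μ] ≤ 0 :=
    discrim_le_zero fun c => by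
      have hnonneg := variance_nonneg (U + c • V) μ
      rw [variance_add hU (hV.const_smul c), variance_smul, covariance_smul_right] at hnonneg
      linarith
  rw [discrim] at hdiscrim
  linarith

theorem IsStationaryDistribution.dotProduct_one {m : ℕ} {P : Matrix (Fin m) (Fin m) ℝ}
    {p : Fin m → ℝ} (hp : IsStationaryDistribution P p) : p ⬝ᵥ 1 = 1 :=
  (_root_.dotProduct_one p).trans hp.mem_stdSimplex.2

/-- The indicator of the event `X_i = a`. -/
noncomputable def letterIndicator {Ω : Type*} {m : ℕ} (X : ℕ → Ω → Fin m) (a : Fin m)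
    (i : ℕ) : Ω → ℝ :=
  {ω | X i ω = a}.indicator 1

theorem centeredCount_eq_sum_letterIndicator_sub {Ω : Type*} {m : ℕ} (p : Fin m → ℝ)
    (X : ℕ → Ω → Fin m) (a : Fin m) (k : ℕ) :
    centeredCount p X a k =
      fun ω => (∑ i ∈ Finset.range k, letterIndicator X a (i + 1)) ω - p a * k := by
  ext ω
  rw [← sum_Icc_one_eq_sum_range]
  simp [centeredCount, letterIndicator, Set.indicator_apply]

theorem sum_centeredCount {Ω : Type*} {m : ℕ} {p : Fin m → ℝ} (hp : ∑ a, p a = 1)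
    (X : ℕ → Ω → Fin m) (k : ℕ) : ∑ a, centeredCount p X a k = 0 := by
  ext ω
  have hcount : ∑ a, (((Finset.Icc 1 k).filter fun i => X i ω = a).card : ℝ) = k := by
    rw [← Nat.cast_sum, Finset.sum_card_fiberwise_eq_card_filter]
    simp
  simp [centeredCount, ← Finset.sum_mul, hp, hcount]

namespace IsMarkovChain

variable {Ω : Type*} [MeasurableSpace Ω] {μ : Measure Ω} [IsProbabilityMeasure μ] {m : ℕ}
  {P : Matrix (Fin m) (Fin m) ℝ} {p : Fin m → ℝ} {X : ℕ → Ω → Fin m}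

theorem memLp_letterIndicator (hX : IsMarkovChain P p X μ) (a : Fin m) (i : ℕ) :
    MemLp (letterIndicator X a i) 2 μ :=
  (memLp_const (1 : ℝ)).indicator (hX.measurableSet_eq i a)

theorem memLp_centeredCount (hX : IsMarkovChain P p X μ) (a : Fin m) (k : ℕ) :
    MemLp (centeredCount p X a k) 2 μ := by
  rw [centeredCount_eq_sum_letterIndicator_sub]
  exact (memLp_finsetSum' _ fun i _ => hX.memLp_letterIndicator a (i + 1)).sub (memLp_const _)

theorem covariance_letterIndicator (hX : IsMarkovChain P p X μ) (hpP : Matrix.vecMul p P = p)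
    (i n : ℕ) (a b : Fin m) :
    cov[letterIndicator X a i, letterIndicator X b (i + n); μ] = p a * ((P ^ n) a b - p b) := by
  have hprob : ∀ j c, μ.real {ω | X j ω = c} = p c := fun j c => by
    rw [hX.measureReal_eq, vecMul_pow_eq_self hpP]
  have ha := hX.measurableSet_eq i a
  have hb := hX.measurableSet_eq (i + n) b
  rw [covariance_eq_sub (hX.memLp_letterIndicator a i) (hX.memLp_letterIndicator b (i + n))]
  simp only [letterIndicator, ← Set.inter_indicator_one]
  rw [integral_indicator_one ha, integral_indicator_one hb,
    integral_indicator_one (ha.inter hb), hX.measureReal_eq_inter_eq, vecMul_pow_eq_self hpP,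
    hprob, hprob, mul_sub]

theorem covariance_centeredCount (hX : IsMarkovChain P p X μ) (hpP : Matrix.vecMul p P = p)
    (a b : Fin m) (k : ℕ) :
    cov[centeredCount p X a k, centeredCount p X b k; μ] =
      ∑ i ∈ Finset.range k, (∑ n ∈ Finset.range i, p a * ((P ^ (n + 1)) a b - p b) +
        ∑ n ∈ Finset.range i, p b * ((P ^ (n + 1)) b a - p a) + p a * ((P ^ 0) a b - p b)) := by
  have hind : ∀ a, ∀ i ∈ Finset.range k, MemLp (letterIndicator X a (i + 1)) 2 μ :=
    fun a i _ => hX.memLp_letterIndicator a (i + 1)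
  have hint : ∀ a, Integrable (∑ i ∈ Finset.range k, letterIndicator X a (i + 1)) μ := fun a =>
    (memLp_finsetSum' _ (hind a)).integrable one_le_two
  rw [centeredCount_eq_sum_letterIndicator_sub, centeredCount_eq_sum_letterIndicator_sub,
    covariance_sub_const_left (hint a), covariance_sub_const_right (hint b),
    covariance_sum_sum' (hind a) (hind b)]
  refine sum_range_sum_range_toeplitz (fun i n => ?_) (fun i n => ?_) (fun i => ?_) k
  · rw [← hX.covariance_letterIndicator hpP (i + 1) (n + 1), add_right_comm i 1]
    rfl
  · rw [covariance_comm, ← hX.covariance_letterIndicator hpP (i + 1) (n + 1), add_right_comm i 1]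
    rfl
  · exact hX.covariance_letterIndicator hpP (i + 1) 0 a b

theorem tendsto_asymptoticCov (hX : IsMarkovChain P p X μ)
    (hP : P ∈ Matrix.rowStochastic ℝ (Fin m)) (hirr : P.IsIrreducible)
    (hp : IsStationaryDistribution P p) (a b : Fin m) :
    Tendsto (fun k : ℕ => cov[centeredCount p X a k, centeredCount p X b k; μ] / (k : ℝ)) atTop
      (𝓝 (asymptoticCov p X μ a b)) := by
  have hcesaro := exists_tendsto_cesaro_sum_pow_apply_sub hP hirr hp.vecMul_eq hp.dotProduct_one
  obtain ⟨l₁, hl₁⟩ := hcesaro a b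
  obtain ⟨l₂, hl₂⟩ := hcesaro b a
  refine tendsto_nhds_limUnder ⟨p a * l₁ + p b * l₂ + p a * ((P ^ 0) a b - p b),
    (((hl₁.const_mul (p a)).add (hl₂.const_mul (p b))).add_const _).congr' ?_⟩
  filter_upwards [eventually_ne_atTop 0] with n hn
  rw [hX.covariance_centeredCount hp.vecMul_eq, div_eq_inv_mul]
  simp only [Finset.sum_add_distrib, ← Finset.mul_sum, Finset.sum_const, Finset.card_range,
    nsmul_eq_mul, mul_add, inv_mul_cancel_left₀ (Nat.cast_ne_zero (R := ℝ).2 hn),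
    mul_left_comm (n : ℝ)⁻¹]

theorem sum_asymptoticCov (hX : IsMarkovChain P p X μ) (hP : P ∈ Matrix.rowStochastic ℝ (Fin m))
    (hirr : P.IsIrreducible) (hp : IsStationaryDistribution P p) (a : Fin m) :
    ∑ b, asymptoticCov p X μ a b = 0 := by
  refine tendsto_nhds_unique
    (tendsto_finsetSum Finset.univ fun b _ => hX.tendsto_asymptoticCov hP hirr hp a b) ?_
  refine tendsto_const_nhds.congr fun k => ?_
  rw [← Finset.sum_div, ← covariance_sum_right (fun b => hX.memLp_centeredCount b k)
    (hX.memLp_centeredCount a k), sum_centeredCount hp.mem_stdSimplex.2, covariance_zero_right,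
    zero_div]

theorem asymptoticCov_self_nonneg (hX : IsMarkovChain P p X μ)
    (hP : P ∈ Matrix.rowStochastic ℝ (Fin m)) (hirr : P.IsIrreducible)
    (hp : IsStationaryDistribution P p) (a : Fin m) : 0 ≤ asymptoticCov p X μ a a := by
  refine ge_of_tendsto' (hX.tendsto_asymptoticCov hP hirr hp a a) fun k => ?_
  rw [covariance_self (hX.memLp_centeredCount a k).aemeasurable]
  exact div_nonneg (variance_nonneg _ _) k.cast_nonneg

theorem asymptoticCov_sq_le (hX : IsMarkovChain P p X μ)
    (hP : P ∈ Matrix.rowStochastic ℝ (Fin m)) (hirr : P.IsIrreducible)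
    (hp : IsStationaryDistribution P p) (a b : Fin m) :
    asymptoticCov p X μ a b ^ 2 ≤ asymptoticCov p X μ a a * asymptoticCov p X μ b b := by
  have hlim := hX.tendsto_asymptoticCov hP hirr hp
  refine le_of_tendsto_of_tendsto' ((hlim a b).pow 2) ((hlim a a).mul (hlim b b)) fun k => ?_
  rw [div_pow, div_mul_div_comm, ← sq, covariance_self (hX.memLp_centeredCount a k).aemeasurable,
    covariance_self (hX.memLp_centeredCount b k).aemeasurable]
  exact div_le_div_of_nonneg_right (covariance_sq_le_variance_mul_variance
    (hX.memLp_centeredCount a k) (hX.memLp_centeredCount b k)) (sq_nonneg _)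

end IsMarkovChain

theorem stdDev_mul_stdDev_mul_correlation {m : ℕ} {S : Matrix (Fin m) (Fin m) ℝ} {a b : Fin m}
    (ha : 0 ≤ S a a) (hb : 0 ≤ S b b) (hab : S a b ^ 2 ≤ S a a * S b b) :
    stdDev S a * stdDev S b * correlation S a b = S a b := by
  refine mul_div_cancel_of_imp' fun hzero => ?_
  rw [stdDev, stdDev, ← Real.sqrt_mul ha, Real.sqrt_eq_zero (mul_nonneg ha hb)] at hzero
  exact sq_nonpos_iff _ |>.1 (hab.trans_eq hzero)

end Covariance

/-! ### Laws of Gaussian processes and of continuous processes -/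

section Gaussian

variable {Ω Ω' : Type*} [MeasurableSpace Ω] [MeasurableSpace Ω'] {μ : Measure Ω} {μ' : Measure Ω'}

theorem strongDual_pi_apply_eq_sum {ι : Type*} [Fintype ι] [DecidableEq ι]
    (L : StrongDual ℝ (ι → ℝ)) (v : ι → ℝ) : L v = ∑ i, L (Pi.single i 1) * v i := by
  conv_lhs => rw [← Finset.univ_sum_single v, map_sum]
  refine Finset.sum_congr rfl fun i _ => ?_
  rw [mul_comm, ← smul_eq_mul, ← map_smul, ← Pi.single_smul, smul_eq_mul, mul_one]

theorem integral_strongDual_pi {ι : Type*} [Fintype ι] [DecidableEq ι] {U : Ω → ι → ℝ}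
    (hU : ∀ i, Integrable (fun ω => U ω i) μ) (L : StrongDual ℝ (ι → ℝ)) :
    ∫ ω, L (U ω) ∂μ = ∑ i, L (Pi.single i 1) * ∫ ω, U ω i ∂μ := by
  simp only [strongDual_pi_apply_eq_sum L (U _)]
  rw [integral_finsetSum _ fun i _ => (hU i).const_mul _]
  simp only [integral_const_mul]

theorem variance_strongDual_pi [IsFiniteMeasure μ] {ι : Type*} [Fintype ι] [DecidableEq ι]
    {U : Ω → ι → ℝ} (hU : ∀ i, MemLp (fun ω => U ω i) 2 μ) (L : StrongDual ℝ (ι → ℝ)) :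
    Var[fun ω => L (U ω); μ] = ∑ i, ∑ j, L (Pi.single i 1) *
      L (Pi.single j 1) * cov[fun ω => U ω i, fun ω => U ω j; μ] := by
  simp only [strongDual_pi_apply_eq_sum L (U _)]
  rw [variance_fun_sum fun i => (hU i).const_mul _]
  simp only [covariance_const_mul_left, covariance_const_mul_right, mul_assoc, mul_left_comm]

theorem identDistrib_of_hasGaussianLaw {ι : Type*} [Finite ι] {U : Ω → ι → ℝ} {V : Ω' → ι → ℝ}
    (hU : HasGaussianLaw U μ) (hV : HasGaussianLaw V μ')
    (hmean : ∀ i, ∫ ω, U ω i ∂μ = ∫ ω, V ω i ∂μ')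
    (hcov : ∀ i j, cov[fun ω => U ω i, fun ω => U ω j; μ] =
      cov[fun ω => V ω i, fun ω => V ω j; μ']) :
    IdentDistrib U V μ μ' := by
  classical
  cases nonempty_fintype ι
  have := hU.isProbabilityMeasure
  have := hV.isProbabilityMeasure
  have hU2 : ∀ i, MemLp (fun ω => U ω i) 2 μ := fun i => (hU.eval i).memLp_two
  have hV2 : ∀ i, MemLp (fun ω => V ω i) 2 μ' := fun i => (hV.eval i).memLp_two
  have := hU.isGaussian_map
  have := hV.isGaussian_map
  refine ⟨hU.aemeasurable, hV.aemeasurable, Measure.ext_of_charFunDual (funext fun L => ?_)⟩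
  rw [hU.charFunDual_map_eq_fun, hV.charFunDual_map_eq_fun, variance_strongDual_pi hU2,
    variance_strongDual_pi hV2, integral_strongDual_pi fun i => (hU2 i).integrable one_le_two,
    integral_strongDual_pi fun i => (hV2 i).integrable one_le_two]
  simp only [hmean, hcov]

theorem identDistrib_of_isGaussianProcess {T : Type*} [Countable T] {X : T → Ω → ℝ}
    {Y : T → Ω' → ℝ} (hX : IsGaussianProcess X μ) (hY : IsGaussianProcess Y μ')
    (hmean : ∀ t, ∫ ω, X t ω ∂μ = ∫ ω, Y t ω ∂μ')
    (hcov : ∀ s t, cov[X s, X t; μ] = cov[Y s, Y t; μ']) :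
    IdentDistrib (fun ω t => X t ω) (fun ω t => Y t ω) μ μ' := by
  have hXm : AEMeasurable (fun ω t => X t ω) μ := aemeasurable_pi_lambda _ hX.aemeasurable
  have hYm : AEMeasurable (fun ω t => Y t ω) μ' := aemeasurable_pi_lambda _ hY.aemeasurable
  have hfin : ∀ I : Finset T, μ.map (fun ω => I.restrict (X · ω)) =
      μ'.map fun ω => I.restrict (Y · ω) := fun I =>
    (identDistrib_of_hasGaussianLaw (hX.hasGaussianLaw I) (hY.hasGaussianLaw I)
      (fun t => hmean t) fun s t => hcov s t).map_eq
  have := (hX.hasGaussianLaw ∅).isProbabilityMeasure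
  have := (hY.hasGaussianLaw ∅).isProbabilityMeasure
  have hlim := isProjectiveLimit_map hXm
  simp only [hfin] at hlim
  exact ⟨hXm, hYm, hlim.unique (isProjectiveLimit_map hYm)⟩

end Gaussian

section ContinuousPaths

variable {T E S : Type*} [TopologicalSpace T] [CompactSpace T] [T2Space T]
  [SecondCountableTopology T] [MetricSpace E] [CompleteSpace E] [SecondCountableTopology E]
  [MeasurableSpace E] [BorelSpace E] [Nonempty E] [Countable S] {q : S → T}

/-- By the Lusin–Souslin theorem, restriction to a dense sequence is a Borel isomorphism from the
space of continuous paths onto its image. -/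
theorem exists_measurable_comp_dense_eq (hq : DenseRange q) :
    ∃ Ψ : (S → E) → C(T, E), Measurable[MeasurableSpace.pi, borel C(T, E)] Ψ ∧
      ∀ w : C(T, E), Ψ (w ∘ q) = w := by
  borelize C(T, E)
  have hcont : Continuous fun w : C(T, E) => (w ∘ q : S → E) :=
    continuous_pi fun n => continuous_eval_const (q n)
  have hinj : Function.Injective fun w : C(T, E) => (w ∘ q : S → E) := fun v w h =>
    DFunLike.coe_injective (hq.equalizer v.continuous w.continuous h)
  obtain ⟨Ψ, hΨ, hΨq⟩ := (hcont.measurableEmbedding hinj).exists_measurable_extend measurable_id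
    fun _ => ⟨.const T (Classical.arbitrary E)⟩
  exact ⟨Ψ, hΨ, congrFun hΨq⟩

theorem identDistrib_of_ae_continuous {Ω Ω' Z : Type*} [MeasurableSpace Ω] [MeasurableSpace Ω']
    {μ : Measure Ω} {μ' : Measure Ω'} [TopologicalSpace Z] [MeasurableSpace Z] [BorelSpace Z]
    {X : T → Ω → E} {Y : T → Ω' → E}
    (hX : ∀ᵐ ω ∂μ, Continuous (X · ω)) (hY : ∀ᵐ ω ∂μ', Continuous (Y · ω)) (hq : DenseRange q)
    (h : IdentDistrib (fun ω n => X (q n) ω) (fun ω n => Y (q n) ω) μ μ')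
    {F : (T → E) → Z} (hF : Continuous fun w : C(T, E) => F w) :
    IdentDistrib (fun ω => F (X · ω)) (fun ω => F (Y · ω)) μ μ' := by
  obtain ⟨Ψ, hΨ, hΨq⟩ := exists_measurable_comp_dense_eq (E := E) hq
  borelize C(T, E)
  have hFΨ : Measurable fun y => F (Ψ y) := hF.measurable.comp hΨ
  have hval : ∀ v : T → E, Continuous v → F (Ψ fun n => v (q n)) = F v := fun v hv => by
    rw [show (fun n => v (q n)) = (⟨v, hv⟩ : C(T, E)) ∘ q from rfl, hΨq, ContinuousMap.coe_mk]
  have hXΨ := IdentDistrib.of_ae_eq (hFΨ.comp_aemeasurable h.aemeasurable_fst)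
    (hX.mono fun ω hω => hval _ hω)
  have hYΨ := IdentDistrib.of_ae_eq (hFΨ.comp_aemeasurable h.aemeasurable_snd)
    (hY.mono fun ω hω => hval _ hω)
  exact (hXΨ.symm.trans (h.comp hFΨ)).trans hYΨ

end ContinuousPaths

/-! ### Brownian motion -/

section Brownian

variable {Ω Ω' : Type*} [MeasurableSpace Ω] [MeasurableSpace Ω'] {μ : Measure Ω} {μ' : Measure Ω'}
  {m : ℕ} {C : Matrix (Fin m) (Fin m) ℝ} {B : unitInterval → Ω → Fin m → ℝ}
  {B' : unitInterval → Ω' → Fin m → ℝ}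

theorem IsBrownianMotionWithCov.memLp (hB : IsBrownianMotionWithCov C B μ) (t : unitInterval)
    (a : Fin m) : MemLp (fun ω => B t ω a) 2 μ :=
  ((hB.gaussian.hasGaussianLaw_eval t).eval a).memLp_two

theorem IsBrownianMotionWithCov.isGaussianProcess_uncurry (hB : IsBrownianMotionWithCov C B μ) :
    IsGaussianProcess (fun (q : unitInterval × Fin m) ω => B q.1 ω q.2) μ :=
  hB.gaussian.of_isGaussianProcess fun q => ⟨{q.1},
    ContinuousLinearMap.proj q.2 ∘L ContinuousLinearMap.proj ⟨q.1, by simp⟩, fun _ => rfl⟩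

theorem IsBrownianMotionWithCov.identDistrib (hB : IsBrownianMotionWithCov C B μ)
    (hB' : IsBrownianMotionWithCov C B' μ') {Z : Type*} [TopologicalSpace Z] [MeasurableSpace Z]
    [BorelSpace Z] {F : (unitInterval → Fin m → ℝ) → Z}
    (hF : Continuous fun w : C(unitInterval, Fin m → ℝ) => F w) :
    IdentDistrib (fun ω => F (B · ω)) (fun ω => F (B' · ω)) μ μ' := by
  let q : ℕ × Fin m → unitInterval × Fin m := Prod.map (TopologicalSpace.denseSeq unitInterval) id
  have hlaw := identDistrib_of_isGaussianProcess (hB.isGaussianProcess_uncurry.comp_right q)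
    (hB'.isGaussianProcess_uncurry.comp_right q)
    (fun k => (hB.centered _ _).trans (hB'.centered _ _).symm)
    fun k l => (hB.covariance _ _ _ _).trans (hB'.covariance _ _ _ _).symm
  have hcurry : Measurable fun (y : ℕ × Fin m → ℝ) n a => y (n, a) := by fun_prop
  exact identDistrib_of_ae_continuous hB.continuous hB'.continuous
    (TopologicalSpace.denseRange_denseSeq unitInterval) (hlaw.comp hcurry) hF

/-- The process run backwards in time and started at `0`. -/
def reverseProcess (B : unitInterval → Ω → Fin m → ℝ) (t : unitInterval) (ω : Ω) : Fin m → ℝ :=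
  B (unitInterval.symm t) ω - B 1 ω

theorem IsBrownianMotionWithCov.reverseProcess (hB : IsBrownianMotionWithCov C B μ) :
    IsBrownianMotionWithCov C (reverseProcess B) μ where
  gaussian := by
    classical
    exact hB.gaussian.of_isGaussianProcess fun t => ⟨{unitInterval.symm t, 1},
      ContinuousLinearMap.proj ⟨unitInterval.symm t, by simp⟩ -
        ContinuousLinearMap.proj ⟨1, by simp⟩, fun _ => rfl⟩
  centered t a := by
    have := hB.gaussian.isProbabilityMeasure
    simp only [_root_.reverseProcess, Pi.sub_apply]
    rw [integral_sub ((hB.memLp _ a).integrable one_le_two)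
      ((hB.memLp _ a).integrable one_le_two), hB.centered, hB.centered, sub_zero]
  covariance s t a b := by
    have := hB.gaussian.isProbabilityMeasure
    simp only [_root_.reverseProcess, Pi.sub_apply]
    rw [covariance_fun_sub_fun_sub (hB.memLp _ a) (hB.memLp _ a) (hB.memLp _ b) (hB.memLp _ b)]
    have hmin : min (1 - s : ℝ) (1 - t) - min (1 - s : ℝ) 1 - (min 1 (1 - t : ℝ) - 1) =
        min (s : ℝ) t := by
      rw [min_eq_left (sub_le_self 1 s.2.1), min_eq_right (sub_le_self 1 t.2.1), min_sub_sub_left]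
      linear_combination -min_add_max (s : ℝ) t
    simp only [hB.covariance, unitInterval.coe_symm_eq, Set.Icc.coe_one, ← hmin, min_self]
    ring
  continuous := hB.continuous.mono fun _ hω =>
    (hω.comp unitInterval.continuous_symm).sub continuous_const

theorem IsBrownianMotionWithCov.ae_zero_eq (hB : IsBrownianMotionWithCov C B μ) :
    ∀ᵐ ω ∂μ, B 0 ω = 0 := by
  have := hB.gaussian.isProbabilityMeasure
  have hcoord : ∀ a, ∀ᵐ ω ∂μ, B 0 ω a = 0 := fun a => by
    have hvar : Var[fun ω => B 0 ω a; μ] = 0 := by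
      rw [← covariance_self (hB.memLp 0 a).aemeasurable, hB.covariance]
      simp
    filter_upwards [ae_eq_integral_of_variance_eq_zero (hB.memLp 0 a) hvar] with ω hω
    rw [hω, hB.centered]
  exact (ae_all_iff.2 hcoord).mono fun _ hω => funext hω

theorem IsBrownianMotionWithCov.ae_sum_mul_one_eq_zero (hB : IsBrownianMotionWithCov C B μ)
    {c : Fin m → ℝ} (hc : ∑ a, ∑ b, c a * c b * C a b = 0) :
    ∀ᵐ ω ∂μ, ∑ a, c a * B 1 ω a = 0 := by
  have := hB.gaussian.isProbabilityMeasure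
  have hL2 : ∀ a, MemLp (fun ω => c a * B 1 ω a) 2 μ := fun a => (hB.memLp 1 a).const_mul (c a)
  have hvar : Var[fun ω => ∑ a, c a * B 1 ω a; μ] = 0 := by
    rw [variance_fun_sum hL2, ← hc]
    simp [covariance_const_mul_left, covariance_const_mul_right, hB.covariance, mul_assoc,
      mul_left_comm]
  filter_upwards [ae_eq_integral_of_variance_eq_zero (memLp_finsetSum _ fun a _ => hL2 a) hvar]
    with ω hω
  rw [hω, integral_finsetSum _ fun a _ => (hL2 a).integrable one_le_two]
  simp [integral_const_mul, hB.centered]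

end Brownian

/-! ### Positions of the letters -/

section Ranking

variable {m : ℕ} {p : Fin m → ℝ} {τ : Equiv.Perm (Fin m)} {r : ℕ}

theorem ranked_apply {α β : Type*} [Zero β] (τ : Equiv.Perm (Fin m)) (f : Fin m → α → β) (i : ℕ)
    (t : α) : ranked τ f i t = ranked τ (fun a => f a t) i := by
  unfold ranked
  split_ifs <;> rfl

theorem ranked_val_add_one {α : Type*} [Zero α] (τ : Equiv.Perm (Fin m)) (f : Fin m → α)
    (i : Fin m) : ranked τ f (i + 1) = f (τ i) :=
  dif_pos ⟨by omega, by omega⟩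

theorem continuous_ranked {α β : Type*} [Zero β] [TopologicalSpace α] [TopologicalSpace β]
    (τ : Equiv.Perm (Fin m)) {f : α → Fin m → β} (hf : Continuous f) (i : ℕ) :
    Continuous fun x => ranked τ (f x) i := by
  unfold ranked
  split_ifs
  · exact (continuous_apply _).comp hf
  · exact continuous_const

theorem exists_fin_val_add_one_eq {i : ℕ} (hi : i ∈ Finset.Icc 1 m) :
    ∃ k : Fin m, (k : ℕ) + 1 = i := by
  rw [Finset.mem_Icc] at hi
  exact ⟨⟨i - 1, by omega⟩, Nat.sub_add_cancel hi.1⟩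

theorem sum_ranked {M : Type*} [AddCommMonoid M] (τ : Equiv.Perm (Fin m)) (f : Fin m → M) :
    ∑ i ∈ Finset.Icc 1 m, ranked τ f i = ∑ a, f a := by
  rw [sum_Icc_one_eq_sum_range, Finset.sum_range, ← Equiv.sum_comp τ f]
  exact Finset.sum_congr rfl fun i _ => ranked_val_add_one τ f i

theorem letterMultiplicity_eq_card_filter_ranked (p : Fin m → ℝ) (τ : Equiv.Perm (Fin m)) (r : ℕ) :
    letterMultiplicity p τ r =
      ((Finset.Icc 1 m).filter fun i => ranked τ p i = ranked τ p r).card := by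
  rw [letterMultiplicity, Finset.card_filter, Finset.card_filter, ← sum_ranked τ]
  refine Finset.sum_congr rfl fun i hi => ?_
  obtain ⟨k, rfl⟩ := exists_fin_val_add_one_eq hi
  rw [ranked_val_add_one, ranked_val_add_one]

theorem antitoneOn_ranked (hτ : Antitone (p ∘ τ)) :
    AntitoneOn (ranked τ p) (Finset.Icc 1 m : Finset ℕ) := by
  intro i hi j hj hij
  obtain ⟨k, rfl⟩ := exists_fin_val_add_one_eq (Finset.mem_coe.1 hi)
  obtain ⟨l, rfl⟩ := exists_fin_val_add_one_eq (Finset.mem_coe.1 hj)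
  rw [ranked_val_add_one, ranked_val_add_one]
  exact hτ (Nat.add_le_add_iff_right.1 hij)

theorem ranked_lt_ranked_iff_le_lastAbove (hτ : Antitone (p ∘ τ)) (r : ℕ) {i : ℕ}
    (hi : i ∈ Finset.Icc 1 m) : ranked τ p r < ranked τ p i ↔ i ≤ lastAbove p τ r := by
  refine ⟨fun h => Finset.le_sup (f := id) (Finset.mem_filter.2 ⟨hi, h⟩), fun h => ?_⟩
  have hpos : ⊥ < i := (Finset.mem_Icc.1 hi).1
  obtain ⟨j, hj, hij⟩ := (Finset.le_sup_iff hpos).1 h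
  rw [Finset.mem_filter] at hj
  exact hj.2.trans_le (antitoneOn_ranked hτ hi hj.1 hij)

theorem lastAbove_lt (hτ : Antitone (p ∘ τ)) (hr : r ∈ Finset.Icc 1 m) : lastAbove p τ r < r := by
  rw [← not_le, ← ranked_lt_ranked_iff_le_lastAbove hτ r hr]
  exact lt_irrefl _

theorem le_lastAbove_add_letterMultiplicity (hτ : Antitone (p ∘ τ)) (hr : r ∈ Finset.Icc 1 m) :
    r ≤ lastAbove p τ r + letterMultiplicity p τ r := by
  have hsub : Finset.Icc (lastAbove p τ r + 1) r ⊆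
      (Finset.Icc 1 m).filter fun i => ranked τ p i = ranked τ p r := fun i hi => by
    rw [Finset.mem_Icc] at hi
    have hi' : i ∈ Finset.Icc 1 m := Finset.mem_Icc.2
      ⟨(Nat.le_add_left 1 _).trans hi.1, hi.2.trans (Finset.mem_Icc.1 hr).2⟩
    refine Finset.mem_filter.2 ⟨hi', le_antisymm (not_lt.1 ?_) (antitoneOn_ranked hτ hi' hr hi.2)⟩
    rw [ranked_lt_ranked_iff_le_lastAbove hτ r hi']
    omega
  have hcard := Finset.card_le_card hsub
  rw [Nat.card_Icc, ← letterMultiplicity_eq_card_filter_ranked] at hcard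
  omega

theorem lastAbove_add_letterMultiplicity_le (hτ : Antitone (p ∘ τ)) (hr : r ∈ Finset.Icc 1 m) :
    lastAbove p τ r + letterMultiplicity p τ r ≤ m := by
  have hsub : ((Finset.Icc 1 m).filter fun i => ranked τ p i = ranked τ p r) ⊆
      Finset.Icc (lastAbove p τ r + 1) m := fun i hi => by
    rw [Finset.mem_filter] at hi
    have hlt := (ranked_lt_ranked_iff_le_lastAbove hτ r hi.1).not.1 hi.2.not_gt
    exact Finset.mem_Icc.2 ⟨not_le.1 hlt, (Finset.mem_Icc.1 hi.1).2⟩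
  have hcard := Finset.card_le_card hsub
  have hlt := lastAbove_lt hτ hr
  rw [Nat.card_Icc, ← letterMultiplicity_eq_card_filter_ranked] at hcard
  rw [Finset.mem_Icc] at hr
  omega

theorem sum_Icc_one_eq_add_add {M : Type*} [AddCommMonoid M] (f : ℕ → M) {a d n : ℕ}
    (h : a + d ≤ n) :
    ∑ i ∈ Finset.Icc 1 n, f i = ∑ i ∈ Finset.Icc 1 a, f i + ∑ ℓ ∈ Finset.Icc 1 d, f (a + ℓ) +
      ∑ i ∈ Finset.Icc (a + d + 1) n, f i := by
  rw [← Finset.Ico_add_one_right_eq_Icc (a + d + 1) n, ← Finset.sum_Ico_add' f,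
    sum_Icc_one_eq_sum_range, sum_Icc_one_eq_sum_range, sum_Icc_one_eq_sum_range,
    ← Finset.sum_range_add_sum_Ico _ h, Finset.sum_range_add (fun k => f (k + 1))]
  simp only [add_assoc]

end Ranking

/-! ### The functionals -/

section Functionals

variable {Ω : Type*} {m : ℕ} {p : Fin m → ℝ} {τ : Equiv.Perm (Fin m)} {r : ℕ}
  {B : unitInterval → Ω → Fin m → ℝ} {ω : Ω}

theorem rankedPath_apply (sd : Fin m → ℝ) (τ : Equiv.Perm (Fin m))
    (B : unitInterval → Ω → Fin m → ℝ) (ω : Ω) (i : ℕ) (t : unitInterval) :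
    rankedPath sd τ B ω i t = ranked τ (fun a => sd a * B t ω a) i :=
  ranked_apply τ _ i t

theorem continuous_rankedPath (sd : Fin m → ℝ) (τ : Equiv.Perm (Fin m))
    (hB : Continuous fun t => B t ω) (i : ℕ) : Continuous (rankedPath sd τ B ω i) := by
  simp only [funext (rankedPath_apply sd τ B ω i)]
  exact continuous_ranked τ (by fun_prop) i

theorem rankedPath_zero_eq_zero (sd : Fin m → ℝ) (τ : Equiv.Perm (Fin m)) (h0 : B 0 ω = 0)
    (i : ℕ) : rankedPath sd τ B ω i 0 = 0 := by
  simp [rankedPath_apply, ranked, h0]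

theorem sum_rankedPath (sd : Fin m → ℝ) (τ : Equiv.Perm (Fin m))
    (B : unitInterval → Ω → Fin m → ℝ) (ω : Ω) (t : unitInterval) :
    ∑ i ∈ Finset.Icc 1 m, rankedPath sd τ B ω i t = ∑ a, sd a * B t ω a := by
  simp only [rankedPath_apply, sum_ranked]

theorem rankedPath_reverseProcess (sd : Fin m → ℝ) (τ : Equiv.Perm (Fin m))
    (B : unitInterval → Ω → Fin m → ℝ) (ω : Ω) (i : ℕ) :
    rankedPath sd τ (reverseProcess B) ω i = reversePath (rankedPath sd τ B ω i) := by
  ext t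
  simp only [reversePath, rankedPath_apply, ranked, reverseProcess, Pi.sub_apply]
  split_ifs <;> ring

theorem continuous_rankedPath_eval {α : Type*} [TopologicalSpace α] (sd : Fin m → ℝ)
    (τ : Equiv.Perm (Fin m)) {w : α → C(unitInterval, Fin m → ℝ)} {u : α → unitInterval}
    (hw : Continuous w) (hu : Continuous u) (i : ℕ) :
    Continuous fun x => rankedPath sd τ Function.eval (w x) i (u x) := by
  simp only [rankedPath_apply, Function.eval]
  exact continuous_ranked τ (by fun_prop) i

theorem continuous_mirrorFunctional (p sd : Fin m → ℝ) (τ : Equiv.Perm (Fin m)) (r : ℕ) :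
    Continuous fun w : C(unitInterval, Fin m → ℝ) =>
      mirrorFunctional p sd τ Function.eval r w := by
  have hsum : ∀ a s d, Continuous fun q : C(unitInterval, Fin m → ℝ) × (ℕ → ℕ → unitInterval) =>
      staircaseSum s d (fun ℓ => rankedPath sd τ Function.eval q.1 (a + ℓ)) q.2 := fun a s d =>
    continuous_finsetSum _ fun j _ => continuous_finsetSum _ fun ℓ _ =>
      (continuous_rankedPath_eval sd τ continuous_fst (by fun_prop) (a + ℓ)).fun_sub
        (continuous_rankedPath_eval sd τ continuous_fst (by fun_prop) (a + ℓ))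
  exact .add (continuous_finsetSum _ fun i _ =>
      continuous_rankedPath_eval sd τ continuous_id continuous_const i)
    ((isCompact_staircase _ _).continuous_sSup (hsum _ _ _))

theorem limitFunctional_eq_mirrorFunctional_reverseProcess (hτ : Antitone (p ∘ τ))
    {sd : Fin m → ℝ} (hr : r ∈ Finset.Icc 1 m) (hcont : Continuous fun t => B t ω)
    (h0 : B 0 ω = 0) (h1 : ∑ a, sd a * B 1 ω a = 0) :
    limitFunctional p sd τ B r ω = mirrorFunctional p sd τ (reverseProcess B) r ω := by
  have hlt := lastAbove_lt hτ hr
  have hle := le_lastAbove_add_letterMultiplicity hτ hr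
  have hsplit := sum_Icc_one_eq_add_add (fun i => rankedPath sd τ B ω i 1)
    (lastAbove_add_letterMultiplicity_le hτ hr)
  rw [sum_rankedPath, h1] at hsplit
  rw [limitFunctional, mirrorFunctional,
    staircaseMax_eq_add_reversePath (by omega) fun ℓ => continuous_rankedPath sd τ hcont _,
    show letterMultiplicity p τ r - (r - lastAbove p τ r) =
      lastAbove p τ r + letterMultiplicity p τ r - r by omega]
  simp only [rankedPath_reverseProcess, reversePath_one, rankedPath_zero_eq_zero sd τ h0, sub_zero,
    zero_sub, Finset.sum_neg_distrib]
  linear_combination -hsplit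

theorem IsBrownianMotionWithCov.identDistrib_limitFunctional_mirrorFunctional [MeasurableSpace Ω]
    {μ : Measure Ω} {C : Matrix (Fin m) (Fin m) ℝ} (hB : IsBrownianMotionWithCov C B μ)
    (hτ : Antitone (p ∘ τ)) {sd : Fin m → ℝ} (hsd : ∑ a, ∑ b, sd a * sd b * C a b = 0)
    (hr : r ∈ Finset.Icc 1 m) :
    IdentDistrib (limitFunctional p sd τ B r) (mirrorFunctional p sd τ B r) μ μ := by
  have hlaw : IdentDistrib (mirrorFunctional p sd τ (_root_.reverseProcess B) r)
      (mirrorFunctional p sd τ B r) μ μ :=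
    hB.reverseProcess.identDistrib hB (continuous_mirrorFunctional p sd τ r)
  have hae : mirrorFunctional p sd τ (_root_.reverseProcess B) r =ᵐ[μ]
      limitFunctional p sd τ B r := by
    filter_upwards [hB.continuous, hB.ae_zero_eq, hB.ae_sum_mul_one_eq_zero hsd] with ω hc h0 h1
    exact (limitFunctional_eq_mirrorFunctional_reverseProcess hτ hr hc h0 h1).symm
  exact (IdentDistrib.of_ae_eq hlaw.aemeasurable_fst hae).symm.trans hlaw

end Functionals

theorem theorem6_general {Ω Ω' : Type*} [MeasurableSpace Ω] [MeasurableSpace Ω'] {μ : Measure Ω}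
    [IsProbabilityMeasure μ] {μ' : Measure Ω'} {m : ℕ} {P : Matrix (Fin m) (Fin m) ℝ}
    {p : Fin m → ℝ} {X : ℕ → Ω → Fin m} (hP : P ∈ Matrix.rowStochastic ℝ (Fin m))
    (hirr : P.IsIrreducible) (hp : IsStationaryDistribution P p) (hX : IsMarkovChain P p X μ)
    {τ : Equiv.Perm (Fin m)} (hτ : Antitone (p ∘ τ)) {B : unitInterval → Ω' → Fin m → ℝ}
    (hB : IsBrownianMotionWithCov (correlation (asymptoticCov p X μ)) B μ')
    {r : ℕ} (hr : r ∈ Finset.Icc 1 m) :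
    IdentDistrib (limitFunctional p (stdDev (asymptoticCov p X μ)) τ B r)
      (mirrorFunctional p (stdDev (asymptoticCov p X μ)) τ B r) μ' μ' := by
  have hscale : ∀ a b, stdDev (asymptoticCov p X μ) a * stdDev (asymptoticCov p X μ) b *
      correlation (asymptoticCov p X μ) a b = asymptoticCov p X μ a b := fun a b =>
    stdDev_mul_stdDev_mul_correlation (hX.asymptoticCov_self_nonneg hP hirr hp a)
      (hX.asymptoticCov_self_nonneg hP hirr hp b) (hX.asymptoticCov_sq_le hP hirr hp a b)
  refine hB.identDistrib_limitFunctional_mirrorFunctional hτ ?_ hr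
  simp only [hscale, hX.sum_asymptoticCov hP hirr hp, Finset.sum_const_zero]

theorem theorem6 {Ω Ω' : Type*} [MeasurableSpace Ω] [MeasurableSpace Ω']
    (μ : MeasureTheory.Measure Ω) [MeasureTheory.IsProbabilityMeasure μ]
    (μ' : MeasureTheory.Measure Ω') [MeasureTheory.IsProbabilityMeasure μ']
    (m : ℕ) (P : Matrix (Fin m) (Fin m) ℝ) (p : Fin m → ℝ) (X : ℕ → Ω → Fin m)
    (hP : P ∈ Matrix.rowStochastic ℝ (Fin m))
    (hirr : P.IsIrreducible) (haper : IsAperiodic P)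
    (hp : IsStationaryDistribution P p) (hX : IsMarkovChain P p X μ)
    (τ : Equiv.Perm (Fin m)) (hτ : IsRanking p τ)
    (B : unitInterval → Ω' → Fin m → ℝ)
    (hB : IsBrownianMotionWithCov (correlation (asymptoticCov p X μ)) B μ')
    (r : ℕ) (hr : 1 ≤ r) (hrm : r ≤ m - 1) :
    ProbabilityTheory.IdentDistrib
      (limitFunctional p (stdDev (asymptoticCov p X μ)) τ B r)
      (mirrorFunctional p (stdDev (asymptoticCov p X μ)) τ B r) μ' μ' := by
  exact theorem6_general hP hirr hp hX hτ.antitone hB (Finset.mem_Icc.2 ⟨hr, by omega⟩)
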